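/- Let $\rho=e^{-V}\ge 0$ be a weight on $\mathbb R$ (with $V=+\infty$ allowed, so that $\rho$ may vanish), and let $\rho_{t_1}(x)=e^{t_1x}\rho(x)$ be its deformation by the first Toda time $t_1$. Let $I$ be the interior of the set of all real $t_1$ for which $\rho_{t_1}$ is integrable over $\mathbb R$. Let $J\subset\mathbb R$ be a finite union of (possibly unbounded) intervals with endpoints $a_1<\dots<a_m$, $m\ge1$, belonging alternately to $J$ and to its complement, such that $\rho$ does not vanish almost everywhere on $J$. Let $\xi=a_j$ be any one of the endpoints, such that $\rho$ is continuous at $\xi$. For $n\ge 0$ put $$\tau_n^J(t_1)=\frac1{n!}\int_{J^n}\prod_{1\le i<k\le n}(x_k-x_i)^2\prod_{i=1}^n\rho_{t_1}(x_i)\,dx_i,\qquad \tau_n=\tau_n^{\mathbb R},\qquad \tau_0^J=1,$$ and for $n\ge1$ $$U_n=\frac{\tau_{n+1}^J}{\tau_n^J},\qquad W_n=\frac{\tau_{n-1}^J}{\tau_n^J},\qquad v_n=-\frac{\partial}{\partial t_1}\ln\frac{\tau_n^J}{\tau_n}.$$ Regard these as functions of $t_1$ and of the single endpoint $\xi$,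 with the other endpoints fixed. Then for every $n\ge1$ and every $t_1\in I$ the integrals $\tau_k$, and the integrals $\tau_k^J$ for all positions of the moving endpoint near $\xi$, are positive and differentiable in the Toda time on $I$ for all $k\ge0$; all the derivatives below exist; and $$\frac{\partial^2U_n}{\partial\xi\,\partial t_1}=\xi\frac{\partial U_n}{\partial\xi}+2\frac{\partial v_n}{\partial\xi}U_n,\qquad \frac{\partial^2W_n}{\partial\xi\,\partial t_1}=-\xi\frac{\partial W_n}{\partial\xi}+2\frac{\partial v_n}{\partial\xi}W_n,$$ where $\frac{\partial^2}{\partial\xi\,\partial t_1}=\frac{\partial}{\partial\xi}\frac{\partial}{\partial t_1}$. Together with these equations the Toda equation holds: $$\frac{\partial^2\ln\tau_n^J}{\partial t_1^2}=-\frac{\partial v_n}{\partial t_1}+\frac{\partial^2\ln\tau_n}{\partial t_1^2}=U_nW_n .$$ -/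

import Mathlib

open Set Filter Topology MeasureTheory

noncomputable section

namespace UnitaryEnsemble

/-- The finite union of intervals whose endpoints are the points `a 0, a 1, …`: along the real line
the components between consecutive endpoints belong alternately to the set and to its complement,
and the component that is unbounded below belongs to the set iff `leftmost` holds.
(Whether an endpoint itself belongs to the set is immaterial for the integrals below.) -/
def intervalUnion {m : ℕ} (leftmost : Prop) (a : Fin m → ℝ) : Set ℝ :=
  {x | Even (Finset.univ.filter fun i => a i < x).card ↔ leftmost}

/-- The matrix integral over `J ^ n` for the weight `ρ = exp (-V)` deformed by the first Toda time,
`ρ_t (x) = exp (t x) ρ (x)`: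
`τ_n^J (t) = (1 / n!) ∫_{J^n} Δ_n(x)² ∏ ρ_t (x_i) dx_i`. -/
def tau (ρ : ℝ → ℝ) (J : Set ℝ) (n : ℕ) (t : ℝ) : ℝ :=
  (n.factorial : ℝ)⁻¹ *
    ∫ x in Set.pi Set.univ (fun _ : Fin n => J),
      (∏ i : Fin n, ∏ j ∈ Finset.Ioi i, (x j - x i)) ^ 2 *
        ∏ i : Fin n, (Real.exp (t * x i) * ρ (x i))

/-- `U_n = τ_{n+1}^J / τ_n^J`. -/
def ratioU (ρ : ℝ → ℝ) (J : Set ℝ) (n : ℕ) (t : ℝ) : ℝ :=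
  tau ρ J (n + 1) t / tau ρ J n t

/-- `W_n = τ_{n-1}^J / τ_n^J`, for `1 ≤ n`. -/
def ratioW (ρ : ℝ → ℝ) (J : Set ℝ) (n : ℕ) (t : ℝ) : ℝ :=
  tau ρ J (n - 1) t / tau ρ J n t

/-- `v_n = -∂_t ln (τ_n^J / τ_n)`, where `τ_n` is the matrix integral over the whole `ℝ ^ n`. -/
def auxV (ρ : ℝ → ℝ) (J : Set ℝ) (n : ℕ) (t : ℝ) : ℝ :=
  -deriv (fun s => Real.log (tau ρ J n s / tau ρ Set.univ n s)) t

/-- The open set of the times `t` near which the deformed weight `exp (s x) ρ (x)` is integrable. -/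
def admissibleTimes (ρ : ℝ → ℝ) : Set ℝ :=
  interior {s | Integrable (fun x => Real.exp (s * x) * ρ x)}

end UnitaryEnsemble

end

/-! Let `L` be the integral against the weight on `J`, `p_n` its monic orthogonal polynomials, `h_n
= L(p_n²)`, and `σ_n` the subleading coefficient of `p_n`. Andréief's identity gives `τ_n = h_0 ⋯
h_{n-1}`, so `U_n = h_n` and `W_n = 1/h_{n-1}`. Both variables act simply on moments. The time `t`
shifts them, `L'(q) = L(xq)`; the endpoint `ξ` adds a point mass, `L'(q) = c q(ξ)`. A derivative of
`p_n` has degree below `n`, hence is orthogonal to `p_n`. So `∂_t h_n = L(x p_n²) = (σ_n - σ_{n+1})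
h_n`, and by telescoping `∂_t ln τ_n = -σ_n`. Therefore `v_n` is `σ_n` minus a term free of `ξ`.
Differentiating `L(x p_n²)` in `ξ` gives `ξ ∂_ξ h_n + 2 (∂_ξ σ_n) h_n`, the `U` equation. The `W`
equation follows by comparing this, at index `n - 1`, with the derivative of `(σ_{n-1} - σ_n)
h_{n-1}`. Differentiating `L(p_n p_{n-1}) = 0` in `t` gives `∂_t σ_n = -h_n / h_{n-1}`, the Toda
equation. -/

namespace UnitaryEnsemble

open Polynomial

/-! ### Orthogonal polynomials of an abstract moment sequence -/

/-- The linear functional on real polynomials whose moments are `m 0, m 1, …`. -/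
noncomputable def momentFunctional (m : ℕ → ℝ) : ℝ[X] →ₗ[ℝ] ℝ :=
  Polynomial.lsum fun k => m k • LinearMap.id

/-- The monic orthogonal polynomials of the moment sequence `m`, by the Gram-Schmidt recursion. -/
noncomputable def orthoPoly (m : ℕ → ℝ) (n : ℕ) : ℝ[X] :=
  X ^ n - ∑ k : Fin n,
    C (momentFunctional m (X ^ n * orthoPoly m k) /
      momentFunctional m (orthoPoly m k * orthoPoly m k)) * orthoPoly m k
termination_by n
decreasing_by all_goals exact k.isLt

/-- The squared norm of the `n`-th orthogonal polynomial. -/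
noncomputable def orthoNorm (m : ℕ → ℝ) (n : ℕ) : ℝ :=
  momentFunctional m (orthoPoly m n * orthoPoly m n)

/-- The moment sequence `m` is positive definite. -/
def IsPosDefMoment (m : ℕ → ℝ) : Prop :=
  ∀ q : ℝ[X], q ≠ 0 → 0 < momentFunctional m (q * q)

theorem momentFunctional_eq_sum_range (m : ℕ → ℝ) {q : ℝ[X]} {N : ℕ} (hq : q.natDegree < N) :
    momentFunctional m q = ∑ k ∈ Finset.range N, q.coeff k * m k := by
  rw [momentFunctional, Polynomial.lsum_apply, Polynomial.sum_over_range' _ _ _ hq]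
  · simp [mul_comm]
  · simp

theorem momentFunctional_shift (m : ℕ → ℝ) (q : ℝ[X]) :
    momentFunctional (fun k => m (k + 1)) q = momentFunctional m (X * q) := by
  have h : (X * q).natDegree < q.natDegree + 1 + 1 := by
    have := natDegree_mul_le (p := (X : ℝ[X])) (q := q)
    rw [natDegree_X] at this
    omega
  rw [momentFunctional_eq_sum_range _ (Nat.lt_succ_self q.natDegree),
    momentFunctional_eq_sum_range m h, Finset.sum_range_succ' (fun k => (X * q : ℝ[X]).coeff k * m k)]
  simp only [coeff_X_mul, coeff_X_mul_zero, zero_mul, add_zero]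

theorem momentFunctional_geometric (c x : ℝ) (q : ℝ[X]) :
    momentFunctional (fun k => c * x ^ k) q = c * q.eval x := by
  rw [momentFunctional_eq_sum_range _ (Nat.lt_succ_self q.natDegree), eval_eq_sum_range,
    Finset.mul_sum]
  exact Finset.sum_congr rfl fun k _ => by ring

theorem momentFunctional_C_mul (m : ℕ → ℝ) (c : ℝ) (q : ℝ[X]) :
    momentFunctional m (C c * q) = c * momentFunctional m q := by
  rw [← smul_eq_C_mul, map_smul, smul_eq_mul]

/-- Positivity is not needed: Gram-Schmidt only subtracts lower-degree terms, whatever the quotients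
are (a zero denominator gives `0`). Degree bounds thus hold along a whole curve of moments. -/
theorem degree_orthoPoly (m : ℕ → ℝ) (n : ℕ) : (orthoPoly m n).degree = n := by
  induction n using Nat.strong_induction_on with
  | _ n ih =>
    have h : (∑ k : Fin n, C (momentFunctional m (X ^ n * orthoPoly m k) /
        momentFunctional m (orthoPoly m k * orthoPoly m k)) * orthoPoly m k).degree < (n : ℕ) := by
      refine (degree_sum_le _ _).trans_lt ?_
      refine (Finset.sup_lt_iff (WithBot.bot_lt_coe n)).2 fun k _ => ?_
      rw [← smul_eq_C_mul]
      refine (degree_smul_le _ _).trans_lt ?_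
      rw [ih k k.isLt]
      exact Nat.cast_lt.2 k.isLt
    rw [orthoPoly, degree_sub_eq_left_of_degree_lt (by rwa [degree_X_pow]), degree_X_pow]

theorem natDegree_orthoPoly (m : ℕ → ℝ) (n : ℕ) : (orthoPoly m n).natDegree = n :=
  natDegree_eq_of_degree_eq_some (degree_orthoPoly m n)

theorem orthoPoly_ne_zero (m : ℕ → ℝ) (n : ℕ) : orthoPoly m n ≠ 0 := by
  intro h
  have := degree_orthoPoly m n
  simp [h] at this

theorem coeff_orthoPoly_self (m : ℕ → ℝ) (n : ℕ) : (orthoPoly m n).coeff n = 1 := by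
  rw [orthoPoly, coeff_sub, coeff_X_pow_self, finsetSum_coeff, Finset.sum_eq_zero, sub_zero]
  intro k _
  rw [coeff_C_mul, coeff_eq_zero_of_natDegree_lt (by rw [natDegree_orthoPoly]; exact k.isLt),
    mul_zero]

theorem monic_orthoPoly (m : ℕ → ℝ) (n : ℕ) : (orthoPoly m n).Monic := by
  rw [Monic, leadingCoeff, natDegree_orthoPoly, coeff_orthoPoly_self]

theorem IsPosDefMoment.orthoNorm_pos {m : ℕ → ℝ} (hm : IsPosDefMoment m) (n : ℕ) :
    0 < orthoNorm m n :=
  hm _ (orthoPoly_ne_zero m n)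

theorem IsPosDefMoment.orthogonal_of_lt {m : ℕ → ℝ} (hm : IsPosDefMoment m) {n k : ℕ}
    (hk : k < n) : momentFunctional m (orthoPoly m n * orthoPoly m k) = 0 := by
  induction n using Nat.strong_induction_on generalizing k with
  | _ n ih =>
    have hz : momentFunctional m (∑ l : Fin n, C (momentFunctional m (X ^ n * orthoPoly m l) /
        momentFunctional m (orthoPoly m l * orthoPoly m l)) * orthoPoly m l * orthoPoly m k) =
        momentFunctional m (X ^ n * orthoPoly m k) := by
      rw [map_sum, Finset.sum_eq_single (⟨k, hk⟩ : Fin n)]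
      · rw [mul_assoc, momentFunctional_C_mul, div_mul_cancel₀]
        exact (hm.orthoNorm_pos k).ne'
      · intro l _ hl
        rw [mul_assoc, momentFunctional_C_mul]
        have hne : (l : ℕ) ≠ k := fun h => hl (Fin.ext h)
        rcases lt_or_gt_of_ne hne with h | h
        · rw [mul_comm (orthoPoly m l) (orthoPoly m k), ih k hk h, mul_zero]
        · rw [ih l l.isLt h, mul_zero]
      · simp
    rw [orthoPoly, sub_mul, Finset.sum_mul, map_sub, hz, sub_self]

theorem IsPosDefMoment.orthogonal {m : ℕ → ℝ} (hm : IsPosDefMoment m) {n k : ℕ}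
    (hk : n ≠ k) : momentFunctional m (orthoPoly m n * orthoPoly m k) = 0 := by
  rcases lt_or_gt_of_ne hk with h | h
  · rw [mul_comm, hm.orthogonal_of_lt h]
  · exact hm.orthogonal_of_lt h

theorem degree_sub_coeff_mul_orthoPoly_lt (m : ℕ → ℝ) {n : ℕ} {q : ℝ[X]}
    (hq : q.degree < (n + 1 : ℕ)) : (q - C (q.coeff n) * orthoPoly m n).degree < (n : ℕ) := by
  rw [degree_lt_iff_coeff_zero] at hq ⊢
  intro i hi
  rw [coeff_sub, coeff_C_mul]
  rcases hi.eq_or_lt with rfl | hi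
  · rw [coeff_orthoPoly_self, mul_one, sub_self]
  · rw [hq i hi, coeff_eq_zero_of_natDegree_lt (p := orthoPoly m n) (by rwa [natDegree_orthoPoly]),
      mul_zero, sub_zero]

theorem IsPosDefMoment.orthoPoly_mul_eq_zero {m : ℕ → ℝ} (hm : IsPosDefMoment m) {N n : ℕ}
    (hN : N ≤ n) {q : ℝ[X]} (hq : q.degree < (N : ℕ)) :
    momentFunctional m (orthoPoly m n * q) = 0 := by
  induction N generalizing q with
  | zero =>
    have : q = 0 := by
      rw [← degree_eq_bot]
      exact Nat.WithBot.lt_zero_iff.1 (by simpa using hq)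
    simp [this]
  | succ N ih =>
    have h := ih (by omega) (degree_sub_coeff_mul_orthoPoly_lt m hq)
    rw [mul_sub, map_sub, mul_left_comm, momentFunctional_C_mul, hm.orthogonal (by omega),
      mul_zero, sub_zero] at h
    exact h

/-- Subtracting the multiple of `p_n` with the same top coefficient leaves a polynomial of degree
below `n`, orthogonal to `p_n`. -/
theorem IsPosDefMoment.orthoPoly_mul {m : ℕ → ℝ} (hm : IsPosDefMoment m) {n : ℕ}
    {q : ℝ[X]} (hq : q.degree < (n + 1 : ℕ)) :
    momentFunctional m (orthoPoly m n * q) = q.coeff n * orthoNorm m n := by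
  have h := hm.orthoPoly_mul_eq_zero le_rfl (degree_sub_coeff_mul_orthoPoly_lt m hq)
  rw [mul_sub, map_sub, mul_left_comm, momentFunctional_C_mul, sub_eq_zero] at h
  exact h

/-- The coefficient of `x ^ (n - 1)` in the `n`-th orthogonal polynomial (`0` for `n = 0`). -/
noncomputable def orthoSubCoeff (m : ℕ → ℝ) (n : ℕ) : ℝ :=
  (X * orthoPoly m n).coeff n

theorem orthoSubCoeff_zero (m : ℕ → ℝ) : orthoSubCoeff m 0 = 0 := by
  simp [orthoSubCoeff]

theorem orthoSubCoeff_succ (m : ℕ → ℝ) (n : ℕ) :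
    orthoSubCoeff m (n + 1) = (orthoPoly m (n + 1)).coeff n := by
  rw [orthoSubCoeff, coeff_X_mul]

/-- The difference `x p_n - p_{n+1}` has degree at most `n`, and its `n`-th coefficient is `σ_n -
σ_{n+1}`. -/
theorem IsPosDefMoment.momentFunctional_X_mul_sq {m : ℕ → ℝ} (hm : IsPosDefMoment m) (n : ℕ) :
    momentFunctional m (X * (orthoPoly m n * orthoPoly m n)) =
      (orthoSubCoeff m n - orthoSubCoeff m (n + 1)) * orthoNorm m n := by
  have hd : ((X : ℝ[X]) * orthoPoly m n - orthoPoly m (n + 1)).degree < (n + 1 : ℕ) := by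
    rw [degree_lt_iff_coeff_zero]
    intro i hi
    obtain ⟨i, rfl⟩ := Nat.exists_eq_add_of_le' (show 1 ≤ i by omega)
    rw [coeff_sub, coeff_X_mul]
    rcases (show n ≤ i by omega).eq_or_lt with rfl | h
    · rw [coeff_orthoPoly_self, coeff_orthoPoly_self, sub_self]
    · rw [coeff_eq_zero_of_natDegree_lt (by rwa [natDegree_orthoPoly]),
        coeff_eq_zero_of_natDegree_lt (by rw [natDegree_orthoPoly]; omega), sub_zero]
  have h := hm.orthoPoly_mul hd
  rw [mul_sub, map_sub, hm.orthogonal (by omega), sub_zero, coeff_sub, ← orthoSubCoeff,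
    ← orthoSubCoeff_succ] at h
  rw [← h, mul_left_comm]

/-! ### Variation of orthogonal polynomials with the moments -/

/-- Coefficientwise differentiability of a curve of polynomials. -/
def HasCoeffDerivAt (p : ℝ → ℝ[X]) (p' : ℝ[X]) (s : ℝ) : Prop :=
  ∀ i, HasDerivAt (fun s => (p s).coeff i) (p'.coeff i) s

theorem HasCoeffDerivAt.mul {p q : ℝ → ℝ[X]} {p' q' : ℝ[X]} {s : ℝ}
    (hp : HasCoeffDerivAt p p' s) (hq : HasCoeffDerivAt q q' s) :
    HasCoeffDerivAt (fun s => p s * q s) (p' * q s + p s * q') s := by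
  intro i
  simp only [coeff_add, coeff_mul, ← Finset.sum_add_distrib]
  exact HasDerivAt.fun_sum fun x _ => (hp x.1).mul (hq x.2)

theorem HasCoeffDerivAt.const_mul {p : ℝ → ℝ[X]} {p' : ℝ[X]} {s : ℝ} (q : ℝ[X])
    (hp : HasCoeffDerivAt p p' s) : HasCoeffDerivAt (fun s => q * p s) (q * p') s := by
  have h : HasCoeffDerivAt (fun _ => q) 0 s := fun i => by simpa using hasDerivAt_const s _
  simpa using h.mul hp

/-- A degree bound uniform in `s` makes the pairing a fixed finite sum, to which the product rule
applies. -/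
theorem HasCoeffDerivAt.momentFunctional {p : ℝ → ℝ[X]} {p' : ℝ[X]} {s : ℝ} {m : ℝ → ℕ → ℝ}
    {m' : ℕ → ℝ} (hp : HasCoeffDerivAt p p' s)
    (hm : ∀ k, HasDerivAt (fun s => m s k) (m' k) s) {N : ℕ} (hN : ∀ s, (p s).natDegree < N) :
    HasDerivAt (fun s => momentFunctional (m s) (p s))
      (momentFunctional m' (p s) + momentFunctional (m s) p') s := by
  have hN' : p'.natDegree < N := by
    have hN0 : 0 < N := (Nat.zero_le _).trans_lt (hN 0)
    have hz : ∀ i, N ≤ i → p'.coeff i = 0 := by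
      intro i hi
      refine (hp i).unique ?_
      have : (fun s => (p s).coeff i) = fun _ => 0 :=
        funext fun s => coeff_eq_zero_of_natDegree_lt ((hN s).trans_le hi)
      rw [this]
      exact hasDerivAt_const s 0
    by_contra h
    have := hz _ (not_lt.1 h)
    have h0 : p' ≠ 0 := by
      rintro rfl
      simp at h
      omega
    exact h0 (leadingCoeff_eq_zero.1 this)
  simp only [momentFunctional_eq_sum_range _ (hN _), momentFunctional_eq_sum_range _ hN',
    ← Finset.sum_add_distrib]
  refine HasDerivAt.fun_sum fun k _ => ?_
  rw [add_comm]
  exact (hp k).mul (hm k)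

/-- The leading coefficient is constantly `1`, so the derivative drops in degree. Positivity at `s`
alone suffices, as it keeps the Gram-Schmidt denominators nonzero there. -/
theorem exists_hasCoeffDerivAt_orthoPoly {s : ℝ} {m : ℝ → ℕ → ℝ} {m' : ℕ → ℝ}
    (hpos : IsPosDefMoment (m s)) (hm : ∀ k, HasDerivAt (fun s => m s k) (m' k) s) (n : ℕ) :
    ∃ p' : ℝ[X], p'.degree < (n : ℕ) ∧ HasCoeffDerivAt (fun s => orthoPoly (m s) n) p' s := by
  induction n using Nat.strong_induction_on with
  | _ n ih =>
    have hdiff : ∀ i, ∃ d, HasDerivAt (fun s => (orthoPoly (m s) n).coeff i) d s := by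
      intro i
      have key : ∀ k : Fin n, ∃ d, HasDerivAt (fun s =>
          (C (momentFunctional (m s) (X ^ n * orthoPoly (m s) k) /
            momentFunctional (m s) (orthoPoly (m s) k * orthoPoly (m s) k)) *
              orthoPoly (m s) k).coeff i) d s := by
        intro k
        obtain ⟨p', -, hp'⟩ := ih k k.isLt
        have h1 := (hp'.const_mul (X ^ n)).momentFunctional hm (N := n + k + 1) fun s => by
          have := natDegree_mul_le (p := (X ^ n : ℝ[X])) (q := orthoPoly (m s) k)
          rw [natDegree_X_pow, natDegree_orthoPoly] at this
          omega
        have h2 := (hp'.mul hp').momentFunctional hm (N := k + k + 1) fun s => by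
          have := natDegree_mul_le (p := orthoPoly (m s) k) (q := orthoPoly (m s) k)
          rw [natDegree_orthoPoly] at this
          omega
        simp only [coeff_C_mul]
        exact ⟨_, (h1.div h2 (hpos.orthoNorm_pos k).ne').mul (hp' i)⟩
      choose d hd using key
      refine ⟨0 - ∑ k, d k, ?_⟩
      have : (fun s => (orthoPoly (m s) n).coeff i) = fun s => (X ^ n : ℝ[X]).coeff i -
          ∑ k : Fin n, (C (momentFunctional (m s) (X ^ n * orthoPoly (m s) k) /
            momentFunctional (m s) (orthoPoly (m s) k * orthoPoly (m s) k)) *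
              orthoPoly (m s) k).coeff i := by
        funext s
        conv_lhs => rw [orthoPoly]
        rw [coeff_sub, finsetSum_coeff]
      rw [this]
      exact (hasDerivAt_const s _).sub (HasDerivAt.fun_sum fun k _ => hd k)
    choose d hd using hdiff
    have hz : ∀ i, n ≤ i → d i = 0 := by
      intro i hi
      refine (hd i).unique ?_
      rcases hi.eq_or_lt with rfl | hi
      · simp only [coeff_orthoPoly_self]
        exact hasDerivAt_const s 1
      · have : (fun s => (orthoPoly (m s) n).coeff i) = fun _ => 0 :=
          funext fun s => coeff_eq_zero_of_natDegree_lt (by rwa [natDegree_orthoPoly])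
        rw [this]
        exact hasDerivAt_const s 0
    have hc : ∀ i, (∑ k ∈ Finset.range n, C (d k) * X ^ k : ℝ[X]).coeff i = d i := by
      intro i
      simp only [finsetSum_coeff, coeff_C_mul_X_pow]
      rw [Finset.sum_ite_eq]
      split_ifs with h
      · rfl
      · exact (hz i (by simpa using h)).symm
    refine ⟨∑ k ∈ Finset.range n, C (d k) * X ^ k, ?_, fun i => ?_⟩
    · rw [degree_lt_iff_coeff_zero]
      intro i hi
      rw [hc, hz i hi]
    · rw [hc]
      exact hd i

theorem hasDerivAt_orthoSubCoeff {s : ℝ} {m : ℝ → ℕ → ℝ} {p' : ℝ[X]} {n : ℕ}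
    (hp : HasCoeffDerivAt (fun s => orthoPoly (m s) n) p' s) :
    HasDerivAt (fun s => orthoSubCoeff (m s) n) ((X * p').coeff n) s :=
  hp.const_mul X n

/-- The variation of `p_n` contributes `2 L(p_n p_n') = 0`; only the variation of the moments
survives. -/
theorem hasDerivAt_orthoNorm {s : ℝ} {m : ℝ → ℕ → ℝ} {m' : ℕ → ℝ}
    (hpos : IsPosDefMoment (m s)) (hm : ∀ k, HasDerivAt (fun s => m s k) (m' k) s) (n : ℕ) :
    HasDerivAt (fun s => orthoNorm (m s) n)
      (momentFunctional m' (orthoPoly (m s) n * orthoPoly (m s) n)) s := by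
  obtain ⟨p', hd, hp'⟩ := exists_hasCoeffDerivAt_orthoPoly hpos hm n
  have h := (hp'.mul hp').momentFunctional hm (N := n + n + 1) fun s => by
    have := natDegree_mul_le (p := orthoPoly (m s) n) (q := orthoPoly (m s) n)
    rw [natDegree_orthoPoly] at this
    omega
  rw [mul_comm p', map_add, hpos.orthoPoly_mul_eq_zero le_rfl hd, add_zero, add_zero] at h
  exact h

/-- The derivative of the subleading coefficient along the Toda flow `m k' = m (k + 1)`. -/
theorem hasDerivAt_orthoSubCoeff_of_shift {s : ℝ} {m : ℝ → ℕ → ℝ}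
    (hpos : ∀ᶠ r in 𝓝 s, IsPosDefMoment (m r))
    (hm : ∀ k, HasDerivAt (fun s => m s k) (m s (k + 1)) s) (n : ℕ) :
    HasDerivAt (fun s => orthoSubCoeff (m s) (n + 1))
      (-(orthoNorm (m s) (n + 1) / orthoNorm (m s) n)) s := by
  have hps := hpos.self_of_nhds
  obtain ⟨p', hd, hp'⟩ := exists_hasCoeffDerivAt_orthoPoly hps hm (n + 1)
  obtain ⟨q', hdq, hq'⟩ := exists_hasCoeffDerivAt_orthoPoly hps hm n
  have h := (hp'.mul hq').momentFunctional hm (N := n + 1 + n + 1) fun s => by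
    have := natDegree_mul_le (p := orthoPoly (m s) (n + 1)) (q := orthoPoly (m s) n)
    rw [natDegree_orthoPoly, natDegree_orthoPoly] at this
    omega
  -- Differentiating this orthogonality relation gives `0 = h_{n+1} + σ_{n+1}' h_n`; it must hold
  -- near `s`, not only at `s`.
  have h0 : (fun r => momentFunctional (m r) (orthoPoly (m r) (n + 1) * orthoPoly (m r) n)) =ᶠ[𝓝 s]
      fun _ => 0 := hpos.mono fun r hr => hr.orthogonal (by omega)
  have h1 := h.unique ((hasDerivAt_const s (0 : ℝ)).congr_of_eventuallyEq h0)
  have hXd : ((X : ℝ[X]) * orthoPoly (m s) n).degree < (n + 1 + 1 : ℕ) := by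
    rw [degree_mul, degree_X, degree_orthoPoly]
    norm_cast
    omega
  have hX := hps.orthoPoly_mul hXd
  rw [coeff_X_mul, coeff_orthoPoly_self, one_mul] at hX
  rw [momentFunctional_shift, mul_left_comm, hX, map_add, mul_comm p', hps.orthoPoly_mul hd,
    hps.orthoPoly_mul_eq_zero (Nat.le_succ n) hdq, add_zero] at h1
  have h2 := hasDerivAt_orthoSubCoeff hp'
  rw [coeff_X_mul] at h2
  convert h2 using 1
  have := (hps.orthoNorm_pos n).ne'
  field_simp
  linarith

/-- The derivative of `L (x p_n ²)` along a variation of the measure by a point mass at `x`. -/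
theorem hasDerivAt_momentFunctional_X_mul_sq {s c x : ℝ} {m : ℝ → ℕ → ℝ} {p' : ℝ[X]}
    (hpos : IsPosDefMoment (m s)) (hm : ∀ k, HasDerivAt (fun s => m s k) (c * x ^ k) s) {n : ℕ}
    (hd : p'.degree < (n : ℕ)) (hp : HasCoeffDerivAt (fun s => orthoPoly (m s) n) p' s) :
    HasDerivAt (fun s => momentFunctional (m s) (X * (orthoPoly (m s) n * orthoPoly (m s) n)))
      (x * (c * (orthoPoly (m s) n).eval x ^ 2) +
        2 * (X * p').coeff n * orthoNorm (m s) n) s := by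
  have h := ((hp.mul hp).const_mul X).momentFunctional hm (N := n + n + 2) fun s => by
    have h1 := natDegree_mul_le (p := orthoPoly (m s) n) (q := orthoPoly (m s) n)
    have h2 := natDegree_mul_le (p := (X : ℝ[X])) (q := orthoPoly (m s) n * orthoPoly (m s) n)
    rw [natDegree_orthoPoly] at h1
    rw [natDegree_X] at h2
    omega
  convert h using 1
  -- Since `x p'` has degree at most `n`, its pairing with `p_n` reads off its `n`-th coefficient,
  -- the derivative of `σ_n`.
  have hXd : ((X : ℝ[X]) * p').degree < (n + 1 : ℕ) := by
    rw [degree_lt_iff_coeff_zero] at hd ⊢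
    intro i hi
    obtain ⟨i, rfl⟩ := Nat.exists_eq_add_of_le' (show 1 ≤ i by omega)
    rw [coeff_X_mul, hd i (by omega)]
  have h3 := hpos.orthoPoly_mul hXd
  rw [momentFunctional_geometric, mul_comm p', ← two_mul, mul_left_comm X 2,
    mul_left_comm X (orthoPoly (m s) n) p']
  rw [show (2 : ℝ[X]) = C 2 from rfl, momentFunctional_C_mul, h3]
  simp only [eval_mul, eval_X]
  ring

/-! ### Moments of the deformed weight -/

/-- The moments over `J` of the deformed weight `exp (t x) ρ (x)`. -/
noncomputable def weightMoment (ρ : ℝ → ℝ) (J : Set ℝ) (t : ℝ) (k : ℕ) : ℝ :=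
  ∫ x in J, x ^ k * (Real.exp (t * x) * ρ x)

/-- Measurability of `ρ` is not assumed; it comes from that of the integrable `exp (t x) ρ (x)` on
multiplying by `exp (-t x)`. -/
theorem aestronglyMeasurable_of_mem_admissibleTimes {ρ : ℝ → ℝ} {t : ℝ}
    (ht : t ∈ admissibleTimes ρ) : AEStronglyMeasurable ρ := by
  have h : t ∈ {s | Integrable (fun x => Real.exp (s * x) * ρ x)} := interior_subset ht
  rw [mem_ofPred_eq] at h
  have hc : Continuous fun x : ℝ => Real.exp (-(t * x)) := by fun_prop
  refine (hc.aestronglyMeasurable.mul h.aestronglyMeasurable).congr (ae_of_all _ fun x => ?_)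
  simp only [Pi.mul_apply]
  rw [← mul_assoc, ← Real.exp_add, neg_add_cancel, Real.exp_zero, one_mul]

/-- The measure on `J` with density `ρ`. -/
noncomputable def weightMeasure (ρ : ℝ → ℝ) (J : Set ℝ) : Measure ℝ :=
  (volume.restrict J).withDensity fun x => ENNReal.ofReal (ρ x)

theorem integrable_weightMeasure_iff {ρ : ℝ → ℝ} (hρ : ∀ x, 0 ≤ ρ x)
    (hm : AEStronglyMeasurable ρ) (J : Set ℝ) (f : ℝ → ℝ) :
    Integrable f (weightMeasure ρ J) ↔ IntegrableOn (fun x => f x * ρ x) J := by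
  rw [weightMeasure, integrable_withDensity_iff_integrable_smul₀'
    hm.aemeasurable.restrict.ennreal_ofReal (ae_of_all _ fun x => ENNReal.ofReal_lt_top),
    IntegrableOn]
  simp only [ENNReal.toReal_ofReal (hρ _), smul_eq_mul, mul_comm]

theorem integral_weightMeasure {ρ : ℝ → ℝ} (hρ : ∀ x, 0 ≤ ρ x)
    (hm : AEStronglyMeasurable ρ) (J : Set ℝ) (f : ℝ → ℝ) :
    ∫ x, f x ∂(weightMeasure ρ J) = ∫ x in J, f x * ρ x := by
  rw [weightMeasure, integral_withDensity_eq_integral_toReal_smul₀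
    hm.aemeasurable.restrict.ennreal_ofReal (ae_of_all _ fun x => ENNReal.ofReal_lt_top)]
  simp only [ENNReal.toReal_ofReal (hρ _), smul_eq_mul, mul_comm]

theorem admissibleTimes_subset {ρ : ℝ → ℝ} (hρ : ∀ x, 0 ≤ ρ x)
    (hm : AEStronglyMeasurable ρ) (J : Set ℝ) :
    admissibleTimes ρ ⊆ interior (ProbabilityTheory.integrableExpSet id (weightMeasure ρ J)) := by
  refine interior_mono fun s hs => ?_
  have hs' : Integrable (fun x => Real.exp (s * x) * ρ x) := hs
  exact (integrable_weightMeasure_iff hρ hm J _).2 hs'.integrableOn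

/-- The zeroth moment is the moment generating function of `ρ dx` on `J`, which may be
differentiated under the integral inside its domain. -/
theorem hasDerivAt_weightMoment {ρ : ℝ → ℝ} (hρ : ∀ x, 0 ≤ ρ x) (J : Set ℝ) {t : ℝ}
    (ht : t ∈ admissibleTimes ρ) (k : ℕ) :
    HasDerivAt (fun s => weightMoment ρ J s k) (weightMoment ρ J t (k + 1)) t := by
  have hm := aestronglyMeasurable_of_mem_admissibleTimes ht
  have h := ProbabilityTheory.hasDerivAt_integral_pow_mul_exp_real
    (admissibleTimes_subset hρ hm J ht) k
  simp only [integral_weightMeasure hρ hm, id] at h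
  simpa only [weightMoment, mul_assoc] using h

theorem integrable_pow_mul_weight {ρ : ℝ → ℝ} (hρ : ∀ x, 0 ≤ ρ x) {t : ℝ}
    (ht : t ∈ admissibleTimes ρ) (k : ℕ) :
    Integrable fun x => x ^ k * (Real.exp (t * x) * ρ x) := by
  have hm := aestronglyMeasurable_of_mem_admissibleTimes ht
  have h := ProbabilityTheory.integrable_pow_mul_exp_of_mem_interior_integrableExpSet
    (admissibleTimes_subset hρ hm univ ht) k
  rw [integrable_weightMeasure_iff hρ hm, integrableOn_univ] at h
  simpa only [mul_assoc, id] using h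

theorem eval_mul_weight_eq_sum (q : ℝ[X]) (x w : ℝ) :
    q.eval x * w = ∑ k ∈ Finset.range (q.natDegree + 1), q.coeff k * (x ^ k * w) := by
  rw [eval_eq_sum_range, Finset.sum_mul]
  exact Finset.sum_congr rfl fun k _ => by ring

theorem integrable_eval_mul_weight {ρ : ℝ → ℝ} (hρ : ∀ x, 0 ≤ ρ x) {t : ℝ}
    (ht : t ∈ admissibleTimes ρ) (q : ℝ[X]) :
    Integrable fun x => q.eval x * (Real.exp (t * x) * ρ x) := by
  simp only [eval_mul_weight_eq_sum]
  exact integrable_finsetSum _ fun k _ => (integrable_pow_mul_weight hρ ht k).const_mul _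

theorem momentFunctional_weightMoment {ρ : ℝ → ℝ} (hρ : ∀ x, 0 ≤ ρ x) (J : Set ℝ) {t : ℝ}
    (ht : t ∈ admissibleTimes ρ) (q : ℝ[X]) :
    momentFunctional (weightMoment ρ J t) q =
      ∫ x in J, q.eval x * (Real.exp (t * x) * ρ x) := by
  simp only [eval_mul_weight_eq_sum]
  rw [integral_finsetSum _ fun k _ =>
      ((integrable_pow_mul_weight hρ ht k).const_mul _).integrableOn,
    momentFunctional_eq_sum_range _ (Nat.lt_succ_self _)]
  exact Finset.sum_congr rfl fun k _ => by rw [integral_const_mul, weightMoment]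

/-- A nonzero polynomial has finitely many roots, so its square is positive almost everywhere on the
support of `ρ`. -/
theorem isPosDefMoment_weightMoment {ρ : ℝ → ℝ} (hρ : ∀ x, 0 ≤ ρ x) {J : Set ℝ} {t : ℝ}
    (ht : t ∈ admissibleTimes ρ) (hJ : volume (J ∩ Function.support ρ) ≠ 0) :
    IsPosDefMoment (weightMoment ρ J t) := by
  intro q hq
  rw [momentFunctional_weightMoment hρ J ht, setIntegral_pos_iff_support_of_nonneg_ae
    (ae_of_all _ fun x => ?_) (integrable_eval_mul_weight hρ ht _).integrableOn]
  · have hnull : volume {x | q.IsRoot x} = 0 :=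
      (Polynomial.finite_setOfPred_isRoot hq).measure_zero _
    rw [← measure_sdiff_null hnull] at hJ
    refine (pos_iff_ne_zero.2 hJ).trans_le (measure_mono ?_)
    rintro x ⟨⟨hxJ, hx⟩, hr⟩
    have hr' : q.eval x ≠ 0 := hr
    refine ⟨?_, hxJ⟩
    simp only [Function.mem_support, eval_mul]
    exact mul_ne_zero (mul_ne_zero hr' hr') (mul_ne_zero (Real.exp_pos _).ne' hx)
  · simp only [Pi.zero_apply, eval_mul]
    exact mul_nonneg (mul_self_nonneg _) (mul_nonneg (Real.exp_pos _).le (hρ x))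

/-! ### The matrix integral as a product of norms -/

/-- **Andréief's identity** for polynomials that are orthogonal with respect to `w ∂μ`. -/
theorem integral_det_sq_mul_prod {n : ℕ} (μ : Measure ℝ) [SigmaFinite μ] (p : Fin n → ℝ[X])
    (w : ℝ → ℝ) (hw : ∀ q : ℝ[X], Integrable (fun x => q.eval x * w x) μ)
    (hp : ∀ i j, i ≠ j → ∫ x, (p i * p j).eval x * w x ∂μ = 0) :
    ∫ x, (Matrix.of fun i j => (p j).eval (x i)).det ^ 2 * ∏ i : Fin n, w (x i)
        ∂(Measure.pi fun _ => μ) =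
      n.factorial * ∏ i, ∫ x, (p i * p i).eval x * w x ∂μ := by
  -- After both determinants are expanded, each integral factorizes. For `σ ≠ τ` some factor
  -- vanishes by orthogonality; each of the `n!` diagonal terms gives the same product.
  have hexp : ∀ x : Fin n → ℝ,
      (Matrix.of fun i j => (p j).eval (x i)).det ^ 2 * ∏ i : Fin n, w (x i) =
        ∑ σ : Equiv.Perm (Fin n), ∑ τ : Equiv.Perm (Fin n),
          ((Equiv.Perm.sign σ : ℤ) : ℝ) * ((Equiv.Perm.sign τ : ℤ) : ℝ) *
            ∏ i, ((p (σ i) * p (τ i)).eval (x i) * w (x i)) := by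
    intro x
    rw [← Matrix.det_transpose, Matrix.det_apply', sq, Finset.sum_mul_sum, Finset.sum_mul]
    refine Finset.sum_congr rfl fun σ _ => ?_
    rw [Finset.sum_mul]
    refine Finset.sum_congr rfl fun τ _ => ?_
    simp only [Matrix.transpose_apply, Matrix.of_apply, eval_mul, Finset.prod_mul_distrib]
    ring
  have hint : ∀ σ τ : Equiv.Perm (Fin n), Integrable (fun x : Fin n → ℝ =>
      ((Equiv.Perm.sign σ : ℤ) : ℝ) * ((Equiv.Perm.sign τ : ℤ) : ℝ) *
        ∏ i, ((p (σ i) * p (τ i)).eval (x i) * w (x i))) (Measure.pi fun _ => μ) := fun σ τ =>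
    (Integrable.fintype_prod (f := fun i y => (p (σ i) * p (τ i)).eval y * w y)
      fun i => hw _).const_mul _
  simp only [hexp]
  rw [integral_finsetSum _ fun σ _ => integrable_finsetSum _ fun τ _ => hint σ τ]
  have hσ : ∀ σ : Equiv.Perm (Fin n), ∫ x : Fin n → ℝ, ∑ τ : Equiv.Perm (Fin n),
      ((Equiv.Perm.sign σ : ℤ) : ℝ) * ((Equiv.Perm.sign τ : ℤ) : ℝ) *
        ∏ i, ((p (σ i) * p (τ i)).eval (x i) * w (x i)) ∂(Measure.pi fun _ => μ) =
      ∏ i, ∫ x, (p i * p i).eval x * w x ∂μ := by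
    intro σ
    rw [integral_finsetSum _ fun τ _ => hint σ τ, Finset.sum_eq_single σ]
    · rw [integral_const_mul, integral_fintype_prod_eq_prod
        (fun i y => (p (σ i) * p (σ i)).eval y * w y),
        Equiv.prod_comp σ fun i => ∫ x, (p i * p i).eval x * w x ∂μ, ← Int.cast_mul,
        ← Units.val_mul, Int.units_mul_self, Units.val_one, Int.cast_one, one_mul]
    · intro τ _ hτ
      obtain ⟨i, hi⟩ : ∃ i, σ i ≠ τ i := by
        by_contra! h
        exact hτ (Equiv.ext fun i => (h i).symm)
      rw [integral_const_mul, integral_fintype_prod_eq_prod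
        (fun i y => (p (σ i) * p (τ i)).eval y * w y),
        Finset.prod_eq_zero (Finset.mem_univ i) (hp _ _ hi), mul_zero]
    · simp
  rw [Finset.sum_congr rfl fun σ _ => hσ σ, Finset.sum_const, Finset.card_univ,
    Fintype.card_perm, Fintype.card_fin, nsmul_eq_mul]

/-- Column operations turn the Vandermonde determinant into that of any monic polynomials, here the
orthogonal ones. -/
theorem tau_eq_prod_orthoNorm {ρ : ℝ → ℝ} (hρ : ∀ x, 0 ≤ ρ x) {J : Set ℝ} {t : ℝ}
    (ht : t ∈ admissibleTimes ρ) (hJ : volume (J ∩ Function.support ρ) ≠ 0) (n : ℕ) :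
    tau ρ J n t = ∏ k ∈ Finset.range n, orthoNorm (weightMoment ρ J t) k := by
  have hm := isPosDefMoment_weightMoment hρ ht hJ
  have hvan : ∀ x : Fin n → ℝ, ∏ i : Fin n, ∏ j ∈ Finset.Ioi i, (x j - x i) =
      (Matrix.of fun i j : Fin n => (orthoPoly (weightMoment ρ J t) j).eval (x i)).det := by
    intro x
    rw [← Matrix.det_vandermonde, Matrix.det_eval_matrixOfPolynomials_eq_det_vandermonde x
      (fun j => orthoPoly (weightMoment ρ J t) j) (fun i => natDegree_orthoPoly _ _)
      fun i => monic_orthoPoly _ _]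
  have hr : (volume : Measure (Fin n → ℝ)).restrict (Set.pi Set.univ fun _ => J) =
      Measure.pi fun _ => volume.restrict J := by
    rw [volume_pi, Measure.restrict_pi_pi]
  rw [tau, hr]
  simp only [hvan]
  rw [integral_det_sq_mul_prod (volume.restrict J)
    (fun j : Fin n => orthoPoly (weightMoment ρ J t) j) (fun x => Real.exp (t * x) * ρ x)
    (fun q => (integrable_eval_mul_weight hρ ht q).integrableOn) fun i j hij => ?_]
  · rw [inv_mul_cancel_left₀ (Nat.cast_ne_zero.2 n.factorial_ne_zero), ← Fin.prod_univ_eq_prod_range]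
    refine Finset.prod_congr rfl fun i _ => ?_
    rw [orthoNorm, momentFunctional_weightMoment hρ J ht]
  · rw [← momentFunctional_weightMoment hρ J ht]
    exact hm.orthogonal fun h => hij (Fin.ext h)

theorem tau_pos {ρ : ℝ → ℝ} (hρ : ∀ x, 0 ≤ ρ x) {J : Set ℝ} {t : ℝ}
    (ht : t ∈ admissibleTimes ρ) (hJ : volume (J ∩ Function.support ρ) ≠ 0) (n : ℕ) :
    0 < tau ρ J n t := by
  rw [tau_eq_prod_orthoNorm hρ ht hJ]
  exact Finset.prod_pos fun k _ => (isPosDefMoment_weightMoment hρ ht hJ).orthoNorm_pos k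

/-! ### Derivatives in the Toda time -/

theorem eventually_mem_admissibleTimes {ρ : ℝ → ℝ} {t : ℝ} (ht : t ∈ admissibleTimes ρ) :
    ∀ᶠ s in 𝓝 t, s ∈ admissibleTimes ρ :=
  isOpen_interior.mem_nhds ht

theorem hasDerivAt_orthoNorm_time {ρ : ℝ → ℝ} (hρ : ∀ x, 0 ≤ ρ x) {J : Set ℝ} {t : ℝ}
    (ht : t ∈ admissibleTimes ρ) (hJ : volume (J ∩ Function.support ρ) ≠ 0) (n : ℕ) :
    HasDerivAt (fun s => orthoNorm (weightMoment ρ J s) n)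
      ((orthoSubCoeff (weightMoment ρ J t) n - orthoSubCoeff (weightMoment ρ J t) (n + 1)) *
        orthoNorm (weightMoment ρ J t) n) t := by
  have hm := isPosDefMoment_weightMoment hρ ht hJ
  rw [← hm.momentFunctional_X_mul_sq, ← momentFunctional_shift]
  exact hasDerivAt_orthoNorm hm (hasDerivAt_weightMoment hρ J ht) n

/-- The logarithmic derivatives `σ_k - σ_{k+1}` of the norms telescope, and `σ_0 = 0`. -/
theorem hasDerivAt_tau {ρ : ℝ → ℝ} (hρ : ∀ x, 0 ≤ ρ x) {J : Set ℝ} {t : ℝ}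
    (ht : t ∈ admissibleTimes ρ) (hJ : volume (J ∩ Function.support ρ) ≠ 0) (n : ℕ) :
    HasDerivAt (tau ρ J n) (-orthoSubCoeff (weightMoment ρ J t) n * tau ρ J n t) t := by
  have hev : tau ρ J n =ᶠ[𝓝 t]
      fun s => ∏ k ∈ Finset.range n, orthoNorm (weightMoment ρ J s) k :=
    (eventually_mem_admissibleTimes ht).mono fun s hs => tau_eq_prod_orthoNorm hρ hs hJ n
  rw [tau_eq_prod_orthoNorm hρ ht hJ]
  refine HasDerivAt.congr_of_eventuallyEq ?_ hev
  induction n with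
  | zero => simpa [orthoSubCoeff_zero] using hasDerivAt_const t (1 : ℝ)
  | succ n ih =>
    have hev' : tau ρ J n =ᶠ[𝓝 t]
        fun s => ∏ k ∈ Finset.range n, orthoNorm (weightMoment ρ J s) k :=
      (eventually_mem_admissibleTimes ht).mono fun s hs => tau_eq_prod_orthoNorm hρ hs hJ n
    simp only [Finset.prod_range_succ]
    convert! (ih hev').mul (hasDerivAt_orthoNorm_time hρ ht hJ n) using 1
    ring

theorem ratioU_eq {ρ : ℝ → ℝ} (hρ : ∀ x, 0 ≤ ρ x) {J : Set ℝ} {t : ℝ}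
    (ht : t ∈ admissibleTimes ρ) (hJ : volume (J ∩ Function.support ρ) ≠ 0) (n : ℕ) :
    ratioU ρ J n t = orthoNorm (weightMoment ρ J t) n := by
  have h := (tau_pos hρ ht hJ n).ne'
  rw [ratioU, div_eq_iff h, tau_eq_prod_orthoNorm hρ ht hJ, tau_eq_prod_orthoNorm hρ ht hJ,
    Finset.prod_range_succ, mul_comm]

theorem ratioW_succ_eq {ρ : ℝ → ℝ} (hρ : ∀ x, 0 ≤ ρ x) {J : Set ℝ} {t : ℝ}
    (ht : t ∈ admissibleTimes ρ) (hJ : volume (J ∩ Function.support ρ) ≠ 0) (n : ℕ) :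
    ratioW ρ J (n + 1) t = (orthoNorm (weightMoment ρ J t) n)⁻¹ := by
  have h := ratioU_eq hρ ht hJ n
  rw [← h, ratioU, inv_div, ratioW, Nat.add_sub_cancel]

theorem hasDerivAt_log_tau {ρ : ℝ → ℝ} (hρ : ∀ x, 0 ≤ ρ x) {J : Set ℝ} {t : ℝ}
    (ht : t ∈ admissibleTimes ρ) (hJ : volume (J ∩ Function.support ρ) ≠ 0) (n : ℕ) :
    HasDerivAt (fun s => Real.log (tau ρ J n s)) (-orthoSubCoeff (weightMoment ρ J t) n) t := by
  have hp := (tau_pos hρ ht hJ n).ne'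
  convert! (hasDerivAt_tau hρ ht hJ n).log hp using 1
  rw [mul_div_cancel_right₀ _ hp]

theorem volume_univ_inter_support_ne_zero {ρ : ℝ → ℝ} {J : Set ℝ}
    (hJ : volume (J ∩ Function.support ρ) ≠ 0) :
    volume (Set.univ ∩ Function.support ρ) ≠ 0 := fun h =>
  hJ (measure_mono_null (inter_subset_inter_left _ (subset_univ J)) h)

theorem auxV_eq {ρ : ℝ → ℝ} (hρ : ∀ x, 0 ≤ ρ x) {J : Set ℝ} {t : ℝ}
    (ht : t ∈ admissibleTimes ρ) (hJ : volume (J ∩ Function.support ρ) ≠ 0) (n : ℕ) :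
    auxV ρ J n t =
      orthoSubCoeff (weightMoment ρ J t) n - orthoSubCoeff (weightMoment ρ univ t) n := by
  have hU := volume_univ_inter_support_ne_zero hJ
  have hev : (fun s => Real.log (tau ρ J n s / tau ρ univ n s)) =ᶠ[𝓝 t]
      fun s => Real.log (tau ρ J n s) - Real.log (tau ρ univ n s) :=
    (eventually_mem_admissibleTimes ht).mono fun s hs =>
      Real.log_div (tau_pos hρ hs hJ n).ne' (tau_pos hρ hs hU n).ne'
  have h := ((hasDerivAt_log_tau hρ ht hJ n).sub (hasDerivAt_log_tau hρ ht hU n)).congr_of_eventuallyEq hev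
  rw [auxV, h.deriv]
  ring

theorem hasDerivAt_orthoSubCoeff_time {ρ : ℝ → ℝ} (hρ : ∀ x, 0 ≤ ρ x) {J : Set ℝ} {t : ℝ}
    (ht : t ∈ admissibleTimes ρ) (hJ : volume (J ∩ Function.support ρ) ≠ 0) (n : ℕ) :
    HasDerivAt (fun s => orthoSubCoeff (weightMoment ρ J s) (n + 1))
      (-(ratioU ρ J (n + 1) t * ratioW ρ J (n + 1) t)) t := by
  rw [ratioU_eq hρ ht hJ, ratioW_succ_eq hρ ht hJ, ← div_eq_mul_inv]
  exact hasDerivAt_orthoSubCoeff_of_shift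
    ((eventually_mem_admissibleTimes ht).mono fun s hs => isPosDefMoment_weightMoment hρ hs hJ)
    (hasDerivAt_weightMoment hρ J ht) n

theorem hasDerivAt_deriv_log_tau {ρ : ℝ → ℝ} (hρ : ∀ x, 0 ≤ ρ x) {J : Set ℝ} {t : ℝ}
    (ht : t ∈ admissibleTimes ρ) (hJ : volume (J ∩ Function.support ρ) ≠ 0) (n : ℕ) :
    HasDerivAt (deriv fun s => Real.log (tau ρ J (n + 1) s))
      (ratioU ρ J (n + 1) t * ratioW ρ J (n + 1) t) t := by
  have hev : (deriv fun s => Real.log (tau ρ J (n + 1) s)) =ᶠ[𝓝 t]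
      fun s => -orthoSubCoeff (weightMoment ρ J s) (n + 1) :=
    (eventually_mem_admissibleTimes ht).mono fun s hs => (hasDerivAt_log_tau hρ hs hJ (n + 1)).deriv
  rw [← neg_neg (ratioU ρ J (n + 1) t * ratioW ρ J (n + 1) t)]
  exact (hasDerivAt_orthoSubCoeff_time hρ ht hJ n).neg.congr_of_eventuallyEq hev

theorem hasDerivAt_auxV {ρ : ℝ → ℝ} (hρ : ∀ x, 0 ≤ ρ x) {J : Set ℝ} {t : ℝ}
    (ht : t ∈ admissibleTimes ρ) (hJ : volume (J ∩ Function.support ρ) ≠ 0) (n : ℕ) :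
    HasDerivAt (auxV ρ J (n + 1))
      (ratioU ρ univ (n + 1) t * ratioW ρ univ (n + 1) t -
        ratioU ρ J (n + 1) t * ratioW ρ J (n + 1) t) t := by
  have hU := volume_univ_inter_support_ne_zero hJ
  have hev : auxV ρ J (n + 1) =ᶠ[𝓝 t] fun s =>
      orthoSubCoeff (weightMoment ρ J s) (n + 1) - orthoSubCoeff (weightMoment ρ univ s) (n + 1) :=
    (eventually_mem_admissibleTimes ht).mono fun s hs => auxV_eq hρ hs hJ (n + 1)
  convert! ((hasDerivAt_orthoSubCoeff_time hρ ht hJ n).sub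
    (hasDerivAt_orthoSubCoeff_time hρ ht hU n)).congr_of_eventuallyEq hev using 1
  ring

/-- The form `L(x p_n²)` is kept because its endpoint derivative can be computed directly. -/
theorem deriv_ratioU {ρ : ℝ → ℝ} (hρ : ∀ x, 0 ≤ ρ x) {J : Set ℝ} {t : ℝ}
    (ht : t ∈ admissibleTimes ρ) (hJ : volume (J ∩ Function.support ρ) ≠ 0) (n : ℕ) :
    deriv (ratioU ρ J n) t = momentFunctional (weightMoment ρ J t)
      (X * (orthoPoly (weightMoment ρ J t) n * orthoPoly (weightMoment ρ J t) n)) := by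
  have hev : ratioU ρ J n =ᶠ[𝓝 t] fun s => orthoNorm (weightMoment ρ J s) n :=
    (eventually_mem_admissibleTimes ht).mono fun s hs => ratioU_eq hρ hs hJ n
  rw [(isPosDefMoment_weightMoment hρ ht hJ).momentFunctional_X_mul_sq]
  exact ((hasDerivAt_orthoNorm_time hρ ht hJ n).congr_of_eventuallyEq hev).deriv

theorem deriv_ratioW {ρ : ℝ → ℝ} (hρ : ∀ x, 0 ≤ ρ x) {J : Set ℝ} {t : ℝ}
    (ht : t ∈ admissibleTimes ρ) (hJ : volume (J ∩ Function.support ρ) ≠ 0) (n : ℕ) :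
    deriv (ratioW ρ J (n + 1)) t =
      -((orthoSubCoeff (weightMoment ρ J t) n - orthoSubCoeff (weightMoment ρ J t) (n + 1)) /
        orthoNorm (weightMoment ρ J t) n) := by
  have hev : ratioW ρ J (n + 1) =ᶠ[𝓝 t] fun s => (orthoNorm (weightMoment ρ J s) n)⁻¹ :=
    (eventually_mem_admissibleTimes ht).mono fun s hs => ratioW_succ_eq hρ hs hJ n
  have h0 := ((isPosDefMoment_weightMoment hρ ht hJ).orthoNorm_pos n).ne'
  rw [(((hasDerivAt_orthoNorm_time hρ ht hJ n).fun_inv h0).congr_of_eventuallyEq hev).deriv]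
  field_simp

/-! ### The moving endpoint -/

/-- Flipping the membership of a set across a threshold `ξ`. -/
theorem setIntegral_flip {f : ℝ → ℝ} (hf : Integrable f) {S : Set ℝ} (hS : MeasurableSet S)
    (ξ : ℝ) :
    ∫ x in S ∩ Iic ξ ∪ Sᶜ ∩ Ioi ξ, f x =
      (∫ x in Iic ξ, S.indicator f x) +
        ((∫ x, Sᶜ.indicator f x) - ∫ x in Iic ξ, Sᶜ.indicator f x) := by
  have hd : Disjoint (S ∩ Iic ξ) (Sᶜ ∩ Ioi ξ) :=
    disjoint_compl_right.mono inter_subset_left inter_subset_left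
  have h := integral_add_compl (f := Sᶜ.indicator f) (measurableSet_Iic (a := ξ))
    (hf.indicator hS.compl)
  rw [setIntegral_union hd (hS.compl.inter measurableSet_Ioi) hf.integrableOn hf.integrableOn,
    ← h, add_sub_cancel_left, compl_Iic, setIntegral_indicator hS, setIntegral_indicator hS.compl,
    inter_comm S, inter_comm Sᶜ]

theorem hasDerivAt_setIntegral_Iic {f : ℝ → ℝ} (hf : Integrable f) {ξ : ℝ}
    (hc : ContinuousAt f ξ) : HasDerivAt (fun y => ∫ x in Iic y, f x) (f ξ) ξ := by
  have h := intervalIntegral.integral_hasDerivAt_right (a := ξ) (b := ξ) (f := f)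
    hf.intervalIntegrable hf.aestronglyMeasurable.stronglyMeasurableAtFilter hc
  have he : (fun y => ∫ x in Iic y, f x) =
      fun y => (∫ x in Iic ξ, f x) + ∫ x in ξ..y, f x := by
    funext y
    rw [← intervalIntegral.integral_Iic_sub_Iic hf.integrableOn hf.integrableOn]
    ring
  rw [he]
  exact h.const_add _

/-- If membership in `S` is locally constant at `ξ`, the integral over the flipped set is
differentiable in the threshold. -/
theorem hasDerivAt_setIntegral_flip {S : Set ℝ} (hS : MeasurableSet S) {ξ : ℝ}
    (hloc : ∀ᶠ x in 𝓝 ξ, (x ∈ S ↔ ξ ∈ S)) :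
    ∃ ε : ℝ, ∀ f : ℝ → ℝ, Integrable f → ContinuousAt f ξ →
      HasDerivAt (fun y => ∫ x in S ∩ Iic y ∪ Sᶜ ∩ Ioi y, f x) (ε * f ξ) ξ := by
  classical
  have hcont : ∀ (T : Set ℝ) (f : ℝ → ℝ), (∀ᶠ x in 𝓝 ξ, (x ∈ T ↔ ξ ∈ T)) → ContinuousAt f ξ →
      ContinuousAt (T.indicator f) ξ := by
    intro T f hT hf
    by_cases hξ : ξ ∈ T
    · refine hf.congr (hT.mono fun x hx => ?_)
      rw [indicator_of_mem (hx.2 hξ)]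
    · refine (continuousAt_const (y := (0 : ℝ))).congr (hT.mono fun x hx => ?_)
      rw [indicator_of_notMem fun h => hξ (hx.1 h)]
  -- The sign is `+1` if `ξ ∈ S` and `-1` otherwise: the threshold gains or loses mass. It does not
  -- depend on `f`.
  refine ⟨(if ξ ∈ S then 1 else 0) - (if ξ ∈ Sᶜ then 1 else 0), fun f hf hc => ?_⟩
  simp only [setIntegral_flip hf hS]
  have h1 := hasDerivAt_setIntegral_Iic (hf.indicator hS) (hcont S f hloc hc)
  have h2 := hasDerivAt_setIntegral_Iic (hf.indicator hS.compl)
    (hcont Sᶜ f (hloc.mono fun x hx => not_congr hx) hc)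
  convert! h1.add (h2.const_sub (∫ x, Sᶜ.indicator f x)) using 1
  simp only [indicator_apply]
  split_ifs <;> ring

/-- The union of intervals with alternating membership whose endpoints are the `a i`, `i ≠ j`. -/
def intervalUnionErase {m : ℕ} (leftmost : Prop) (a : Fin m → ℝ) (j : Fin m) : Set ℝ :=
  {x | Even ((Finset.univ.erase j).filter fun i => a i < x).card ↔ leftmost}

theorem measurableSet_intervalUnionErase {m : ℕ} (leftmost : Prop) (a : Fin m → ℝ) (j : Fin m) :
    MeasurableSet (intervalUnionErase leftmost a j) := by
  have hmeas : Measurable fun x => ((Finset.univ.erase j).filter fun i => a i < x).card := by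
    simp only [Finset.card_filter]
    exact Finset.measurable_sum _ fun i _ =>
      Measurable.ite measurableSet_Ioi measurable_const measurable_const
  exact hmeas (MeasurableSet.of_discrete (s := {k : ℕ | Even k ↔ leftmost}))

theorem eventually_mem_intervalUnionErase_iff {m : ℕ} (leftmost : Prop) {a : Fin m → ℝ}
    (ha : StrictMono a) (j : Fin m) :
    ∀ᶠ x in 𝓝 (a j), (x ∈ intervalUnionErase leftmost a j ↔
      a j ∈ intervalUnionErase leftmost a j) := by
  have h : ∀ i : Fin m, i ≠ j → ∀ᶠ x in 𝓝 (a j), (a i < x ↔ a i < a j) := by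
    intro i hi
    rcases lt_or_gt_of_ne (ha.injective.ne hi) with h | h
    · exact (eventually_gt_nhds h).mono fun x hx => iff_of_true hx h
    · exact (eventually_lt_nhds h).mono fun x hx => iff_of_false hx.not_gt h.not_gt
  have h' : ∀ᶠ x in 𝓝 (a j), ∀ i : Fin m, i ≠ j → (a i < x ↔ a i < a j) :=
    eventually_all.2 fun i => by
      by_cases hi : i = j
      · simp [hi]
      · exact (h i hi).mono fun x hx _ => hx
  refine h'.mono fun x hx => ?_
  have : ((Finset.univ.erase j).filter fun i => a i < x) =
      (Finset.univ.erase j).filter fun i => a i < a j :=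
    Finset.filter_congr fun i hi => hx i (Finset.ne_of_mem_erase hi)
  simp only [intervalUnionErase, mem_ofPred_eq, this]

/-- The endpoint `ξ` adds one to the count exactly to its right, flipping the parity there. No
ordering relative to the other endpoints is needed. -/
theorem intervalUnion_update {m : ℕ} (leftmost : Prop) (a : Fin m → ℝ) (j : Fin m) (ξ : ℝ) :
    intervalUnion leftmost (Function.update a j ξ) =
      intervalUnionErase leftmost a j ∩ Iic ξ ∪ (intervalUnionErase leftmost a j)ᶜ ∩ Ioi ξ := by
  ext x
  have hcard : (Finset.univ.filter fun i => Function.update a j ξ i < x).card =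
      (if ξ < x then 1 else 0) + ((Finset.univ.erase j).filter fun i => a i < x).card := by
    rw [Finset.card_filter, ← Finset.add_sum_erase _ _ (Finset.mem_univ j), Function.update_self,
      Finset.card_filter]
    congr 1
    refine Finset.sum_congr rfl fun i hi => ?_
    rw [Function.update_of_ne (Finset.ne_of_mem_erase hi)]
  simp only [intervalUnion, intervalUnionErase, mem_ofPred_eq, mem_union, mem_inter_iff,
    mem_compl_iff, mem_Iic, mem_Ioi, hcard]
  by_cases hx : ξ < x
  · simp only [hx, if_true, not_le.2 hx, and_false, false_or, and_true, Nat.even_add_one, add_comm 1]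
    tauto
  · simp only [hx, if_false, not_lt.1 hx, and_false, or_false, and_true, zero_add]

/-- By the fundamental theorem of calculus, with `c = ± exp (t ξ) ρ (ξ)`. One `c` serves all `k`, so
the varied functional is evaluation at `ξ` times `c`. -/
theorem hasDerivAt_weightMoment_endpoint {ρ : ℝ → ℝ} (hρ : ∀ x, 0 ≤ ρ x) {m : ℕ}
    (leftmost : Prop) {a : Fin m → ℝ} (ha : StrictMono a) {j : Fin m}
    (hξ : ContinuousAt ρ (a j)) {t : ℝ} (ht : t ∈ admissibleTimes ρ) :
    ∃ c : ℝ, ∀ k, HasDerivAt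
      (fun ξ => weightMoment ρ (intervalUnion leftmost (Function.update a j ξ)) t k)
      (c * a j ^ k) (a j) := by
  obtain ⟨ε, hε⟩ := hasDerivAt_setIntegral_flip (measurableSet_intervalUnionErase leftmost a j)
    (eventually_mem_intervalUnionErase_iff leftmost ha j)
  refine ⟨ε * (Real.exp (t * a j) * ρ (a j)), fun k => ?_⟩
  have h := hε _ (integrable_pow_mul_weight hρ ht k) (by fun_prop)
  simp only [weightMoment, intervalUnion_update]
  convert! h using 1
  ring

/-- Positivity of a moment continuous in `ξ` is an open condition, whereas the right-hand side does
not involve `t`: nondegeneracy thus persists near `ξ` for all times at once. -/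
theorem weightMoment_zero_pos_iff {ρ : ℝ → ℝ} (hρ : ∀ x, 0 ≤ ρ x) (J : Set ℝ) {t : ℝ}
    (ht : t ∈ admissibleTimes ρ) :
    0 < weightMoment ρ J t 0 ↔ volume (J ∩ Function.support ρ) ≠ 0 := by
  rw [weightMoment, setIntegral_pos_iff_support_of_nonneg_ae
    (ae_of_all _ fun x => ?_) (integrable_pow_mul_weight hρ ht 0).integrableOn, pos_iff_ne_zero,
    inter_comm]
  · have : (Function.support fun x => x ^ 0 * (Real.exp (t * x) * ρ x)) = Function.support ρ := by
      ext x
      simp [Real.exp_ne_zero]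
    rw [this]
  · simpa using mul_nonneg (Real.exp_pos _).le (hρ x)

end UnitaryEnsemble

/-! ### The AKNS-type and Toda equations -/

theorem theorem5 (ρ : ℝ → ℝ) (hρ : ∀ x, 0 ≤ ρ x)
    {m : ℕ} (leftmost : Prop) (a : Fin m → ℝ) (ha : StrictMono a)
    (hJ : volume (UnitaryEnsemble.intervalUnion leftmost a ∩ Function.support ρ) ≠ 0)
    (j : Fin m) (hξ : ContinuousAt ρ (a j))
    (J : ℝ → Set ℝ)
    (hJdef : J = fun ξ => UnitaryEnsemble.intervalUnion leftmost (Function.update a j ξ))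
    (n : ℕ) (hn : 1 ≤ n) (t : ℝ) (ht : t ∈ UnitaryEnsemble.admissibleTimes ρ) :
    -- all the matrix integrals are positive and differentiable in the Toda time
    (∀ k : ℕ, ∀ s ∈ UnitaryEnsemble.admissibleTimes ρ,
      0 < UnitaryEnsemble.tau ρ Set.univ k s ∧
        DifferentiableAt ℝ (UnitaryEnsemble.tau ρ Set.univ k) s) ∧
    (∀ᶠ ξ in 𝓝 (a j), ∀ k : ℕ, ∀ s ∈ UnitaryEnsemble.admissibleTimes ρ,
      0 < UnitaryEnsemble.tau ρ (J ξ) k s ∧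
        DifferentiableAt ℝ (UnitaryEnsemble.tau ρ (J ξ) k) s) ∧
    -- the two AKNS-type equations
    (∃ Uξ Wξ vξ : ℝ,
      HasDerivAt (fun ξ => UnitaryEnsemble.ratioU ρ (J ξ) n t) Uξ (a j) ∧
      HasDerivAt (fun ξ => UnitaryEnsemble.ratioW ρ (J ξ) n t) Wξ (a j) ∧
      HasDerivAt (fun ξ => UnitaryEnsemble.auxV ρ (J ξ) n t) vξ (a j) ∧
      HasDerivAt (fun ξ => deriv (UnitaryEnsemble.ratioU ρ (J ξ) n) t)
        (a j * Uξ + 2 * vξ * UnitaryEnsemble.ratioU ρ (J (a j)) n t) (a j) ∧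
      HasDerivAt (fun ξ => deriv (UnitaryEnsemble.ratioW ρ (J ξ) n) t)
        (-(a j) * Wξ + 2 * vξ * UnitaryEnsemble.ratioW ρ (J (a j)) n t) (a j)) ∧
    -- the Toda equation
    (∃ vt L : ℝ,
      HasDerivAt (UnitaryEnsemble.auxV ρ (J (a j)) n) vt t ∧
      HasDerivAt (deriv fun s => Real.log (UnitaryEnsemble.tau ρ Set.univ n s)) L t ∧
      HasDerivAt (deriv fun s => Real.log (UnitaryEnsemble.tau ρ (J (a j)) n s)) (-vt + L) t ∧
      -vt + L = UnitaryEnsemble.ratioU ρ (J (a j)) n t *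
        UnitaryEnsemble.ratioW ρ (J (a j)) n t) := by
  open UnitaryEnsemble in
  obtain ⟨n, rfl⟩ := Nat.exists_eq_add_of_le' hn
  have hJa : J (a j) = intervalUnion leftmost a := by
    simp only [hJdef, Function.update_eq_self]
  rw [← hJa] at hJ
  have hU := volume_univ_inter_support_ne_zero hJ
  obtain ⟨c, hc⟩ := hasDerivAt_weightMoment_endpoint hρ leftmost ha hξ ht
  have hd : ∀ k, HasDerivAt (fun ξ => weightMoment ρ (J ξ) t k) (c * a j ^ k) (a j) := by
    rw [hJdef]
    exact hc
  have hJev : ∀ᶠ ξ in 𝓝 (a j), volume (J ξ ∩ Function.support ρ) ≠ 0 := by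
    have h0 := (weightMoment_zero_pos_iff hρ (J (a j)) ht).2 hJ
    exact ((hd 0).continuousAt.eventually_const_lt h0).mono fun ξ h =>
      (weightMoment_zero_pos_iff hρ (J ξ) ht).1 h
  have hpos := isPosDefMoment_weightMoment hρ ht hJ
  refine ⟨fun k s hs => ⟨tau_pos hρ hs hU k, (hasDerivAt_tau hρ hs hU k).differentiableAt⟩,
    hJev.mono fun ξ h k s hs => ⟨tau_pos hρ hs h k, (hasDerivAt_tau hρ hs h k).differentiableAt⟩,
    ?_, ?_⟩
  -- The same `γ = ∂_ξ σ_k` must appear in both derivatives, so they are obtained from one `p'`.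
  · have hγ : ∀ k, ∃ γ : ℝ,
        HasDerivAt (fun ξ => orthoSubCoeff (weightMoment ρ (J ξ) t) k) γ (a j) ∧
        HasDerivAt (fun ξ => deriv (ratioU ρ (J ξ) k) t)
          (a j * (c * (orthoPoly (weightMoment ρ (J (a j)) t) k).eval (a j) ^ 2) +
            2 * γ * orthoNorm (weightMoment ρ (J (a j)) t) k) (a j) := by
      intro k
      obtain ⟨p', hdeg, hp'⟩ := exists_hasCoeffDerivAt_orthoPoly
        (m := fun ξ => weightMoment ρ (J ξ) t) hpos hd k
      exact ⟨_, hasDerivAt_orthoSubCoeff (m := fun ξ => weightMoment ρ (J ξ) t) hp',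
        (hasDerivAt_momentFunctional_X_mul_sq (m := fun ξ => weightMoment ρ (J ξ) t)
          hpos hd hdeg hp').congr_of_eventuallyEq
          (hJev.mono fun ξ h => deriv_ratioU hρ ht h k)⟩
    have hN : ∀ k, HasDerivAt (fun ξ => orthoNorm (weightMoment ρ (J ξ) t) k)
        (c * (orthoPoly (weightMoment ρ (J (a j)) t) k).eval (a j) ^ 2) (a j) := by
      intro k
      convert! hasDerivAt_orthoNorm (m := fun ξ => weightMoment ρ (J ξ) t) hpos hd k using 1
      rw [momentFunctional_geometric, Polynomial.eval_mul, sq]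
    obtain ⟨γ, hγ1, hγ2⟩ := hγ n
    obtain ⟨γ', hγ1', hγ2'⟩ := hγ (n + 1)
    have hh := (hpos.orthoNorm_pos n).ne'
    refine ⟨_, _, γ', (hN (n + 1)).congr_of_eventuallyEq
      (hJev.mono fun ξ h => ratioU_eq hρ ht h (n + 1)), ((hN n).fun_inv hh).congr_of_eventuallyEq
      (hJev.mono fun ξ h => ratioW_succ_eq hρ ht h n),
      -- The whole-line part of `v` is constant in `ξ`.
      (hγ1'.sub_const _).congr_of_eventuallyEq (hJev.mono fun ξ h => auxV_eq hρ ht h (n + 1)),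
      ?_, ?_⟩
    · rw [ratioU_eq hρ ht hJ]
      exact hγ2'
    -- Two expressions for `∂_ξ ∂_t h_n` are equated; after the index shift this `h_n` is the
    -- reciprocal of `W_{n+1}`. The relation eliminates `∂_ξ σ_n` in favour of `∂_ξ σ_{n+1} = ∂_ξ
    -- v_{n+1}`.
    · have hrel := hγ2.unique (((hγ1.sub hγ1').mul (hN n)).congr_of_eventuallyEq
        (hJev.mono fun ξ h => (deriv_ratioU hρ ht h n).trans
          ((isPosDefMoment_weightMoment hρ ht h).momentFunctional_X_mul_sq n)))
      simp only [Pi.sub_apply] at hrel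
      have hW := (((hγ1.sub hγ1').div (hN n) hh).neg).congr_of_eventuallyEq
        (hJev.mono fun ξ h => deriv_ratioW hρ ht h n)
      rw [ratioW_succ_eq hρ ht hJ]
      convert! hW using 1
      simp only [Pi.sub_apply]
      field_simp
      linear_combination hrel
  · refine ⟨_, _, hasDerivAt_auxV hρ ht hJ n, hasDerivAt_deriv_log_tau hρ ht hU n, ?_, ?_⟩
    · convert! hasDerivAt_deriv_log_tau hρ ht hJ n using 1
      ring
    · ring
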